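/- Let $n\ge 0$, $M\ge 1$, $\boldsymbol d=(d_1,\dots,d_n)\in\mathbb N^n$, $d=d_1+\cdots+d_n$, and write $\xi=(\xi_1,\dots,\xi_n)\in\mathbb R^d=\mathbb R^{d_1}\times\cdots\times\mathbb R^{d_n}$, all spaces carrying the Euclidean norm $\|\cdot\|$. For a Borel probability measure $Q$ on $\mathbb R^d$ and $\boldsymbol\varepsilon=(\varepsilon_1,\dots,\varepsilon_n)$ with $\varepsilon_k\ge 0$, let the multi-transport hyperrectangle $\mathcal T_2(Q,\boldsymbol\varepsilon)$ be the set of second marginals of all Borel probability measures $\pi$ on $\mathbb R^d\times\mathbb R^d$ whose first marginal is $Q$ and which satisfy $$\int \|\zeta_k-\xi_k\|^2\,d\pi(\zeta,\xi)\le \varepsilon_k^2\qquad\text{for all }k=1,\dots,n.$$ For $\boldsymbol\lambda\in\mathbb R^n$ let $\mathrm{diag}^{\boldsymbol d}(\boldsymbol\lambda)$ be the $d\times d$ diagonal matrix whose diagonal consists of $d_1$ entries $\lambda_1$, followed by $d_2$ entries $\lambda_2$, and so on up to $d_n$ entries $\lambda_n$. **Proposition (indefinite quadratic objective functions).** Let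 $Q=\sum_{l=1}^M\vartheta_l\delta_{\xi^l}$ with $\xi^1,\dots,\xi^M\in\mathbb R^d$, $\vartheta_l\ge 0$ and $\sum_{l=1}^M\vartheta_l=1$. Let $h(\xi)=\xi^\top\mathcal Q\xi+2q^\top\xi$, where $\mathcal Q\in\mathbb R^{d\times d}$ is symmetric (possibly indefinite) and $q\in\mathbb R^d$. Then $h$ is integrable with respect to every $P\in\mathcal T_2(Q,\boldsymbol\varepsilon)$, and the worst-case expectation $$\sup_{P\in\mathcal T_2(Q,\boldsymbol\varepsilon)}\mathbb E_P[h(\xi)]$$ is equal to the optimal value of the semidefinite program $$\inf_{\boldsymbol\lambda\in\mathbb R^n,\ \boldsymbol\lambda\succeq 0,\ s\in\mathbb R^M}\ \sum_{k=1}^n\lambda_k\varepsilon_k^2+\sum_{l=1}^M\vartheta_l s_l$$ $$\text{s.t.}\quad\begin{bmatrix}\mathrm{diag}^{\boldsymbol d}(\boldsymbol\lambda)-\mathcal Q & q+\mathrm{diag}^{\boldsymbol d}(\boldsymbol\lambda)\xi^l\\ q^\top+{\xi^l}^\top\mathrm{diag}^{\boldsymbol d}(\boldsymbol\lambda) & s_l+{\xi^l}^\top\mathrm{diag}^{\boldsymbol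 d}(\boldsymbol\lambda)\,\xi^l\end{bmatrix}\succeq 0,\qquad l=1,\dots,M.$$ -/

import Mathlib

open MeasureTheory
open scoped ENNReal Matrix

namespace MTH

noncomputable section

/-- `ℝᵈ` with the Euclidean norm, where `d = d₁ + ⋯ + dₙ`. -/
abbrev Space {n : ℕ} (d : Fin n → ℕ) : Type := EuclideanSpace ℝ (Fin (∑ k, d k))

/-- The position of the `j`-th coordinate of the `k`-th block, i.e. `d₁ + ⋯ + d_{k-1} + j`
(all indices counted from zero). -/
def blockIndex {n : ℕ} (d : Fin n → ℕ) (k : Fin n) (j : Fin (d k)) : Fin (∑ k, d k) :=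
  finSigmaFinEquiv ⟨k, j⟩

/-- The number of the block that contains a given coordinate. -/
def blockOf {n : ℕ} (d : Fin n → ℕ) (i : Fin (∑ k, d k)) : Fin n :=
  (finSigmaFinEquiv.symm i).1

/-- The component `ξ_k ∈ ℝ^{d_k}` of `ξ = (ξ₁, …, ξₙ) ∈ ℝᵈ`, with the Euclidean norm on
`ℝ^{d_k}`. -/
def component {n : ℕ} (d : Fin n → ℕ) (k : Fin n) (x : Space d) :
    EuclideanSpace ℝ (Fin (d k)) :=
  WithLp.toLp 2 (fun j => x (blockIndex d k j))

/-- The multi-transport hyperrectangle `𝒯_p(Q, ε)` on `ℝᵈ = ℝ^{d₁} × ⋯ × ℝ^{dₙ}`: all second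
marginals of probability measures `π` on `ℝᵈ × ℝᵈ` with first marginal `Q` and
`∫ ‖ζ_k - ξ_k‖ᵖ dπ(ζ, ξ) ≤ ε_kᵖ` for every `k`. -/
def hyperrectangle {n : ℕ} (d : Fin n → ℕ) (p : ℝ) (Q : Measure (Space d)) (ε : Fin n → ℝ) :
    Set (Measure (Space d)) :=
  {P | ∃ π : Measure (Space d × Space d),
      IsProbabilityMeasure π ∧ π.map Prod.fst = Q ∧
      (∀ k, ∫⁻ z, edist (component d k z.1) (component d k z.2) ^ p ∂π
        ≤ ENNReal.ofReal (ε k) ^ p) ∧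
      π.map Prod.snd = P}

/-- The discrete measure `∑ₗ ϑₗ δ_{ξˡ}`. -/
def discrete {n M : ℕ} (d : Fin n → ℕ) (θ : Fin M → ℝ) (ξ : Fin M → Space d) :
    Measure (Space d) :=
  ∑ l, ENNReal.ofReal (θ l) • Measure.dirac (ξ l)

/-- The worst-case expectation `sup_{P ∈ S} 𝔼_P[h]` as an extended real number. It is the
intended quantity when `h` is integrable under every `P ∈ S`. -/
def worstCase {Ω : Type*} [MeasurableSpace Ω] (S : Set (Measure Ω)) (h : Ω → ℝ) : EReal :=
  ⨆ P ∈ S, ((∫ x, h x ∂P : ℝ) : EReal)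

/-- The quadratic function `h(ξ) = ξᵀ A ξ + 2 qᵀ ξ`. -/
def quadratic {n : ℕ} (d : Fin n → ℕ)
    (A : Matrix (Fin (∑ k, d k)) (Fin (∑ k, d k)) ℝ) (q : Fin (∑ k, d k) → ℝ)
    (x : Space d) : ℝ :=
  x.ofLp ⬝ᵥ (A *ᵥ x.ofLp) + 2 * (q ⬝ᵥ x.ofLp)

/-- The diagonal matrix `diagᵈ(t)`, equal to `t_k` on the `k`-th block of the diagonal. -/
def blockDiag {n : ℕ} (d : Fin n → ℕ) (t : Fin n → ℝ) :
    Matrix (Fin (∑ k, d k)) (Fin (∑ k, d k)) ℝ :=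
  Matrix.diagonal (fun i => t (blockOf d i))

/-- The `(d + 1) × (d + 1)` matrix
`[diagᵈ(t) - A, q + diagᵈ(t) ξ; qᵀ + ξᵀ diagᵈ(t), s + ξᵀ diagᵈ(t) ξ]`. -/
def lmiMatrix {n : ℕ} (d : Fin n → ℕ)
    (A : Matrix (Fin (∑ k, d k)) (Fin (∑ k, d k)) ℝ) (q : Fin (∑ k, d k) → ℝ)
    (x : Space d) (t : Fin n → ℝ) (s : ℝ) :
    Matrix (Fin (∑ k, d k) ⊕ Unit) (Fin (∑ k, d k) ⊕ Unit) ℝ :=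
  Matrix.fromBlocks
    (blockDiag d t - A)
    (Matrix.replicateCol Unit (q + blockDiag d t *ᵥ x.ofLp))
    (Matrix.replicateRow Unit (q + x.ofLp ᵥ* blockDiag d t))
    (Matrix.of fun _ _ => s + x.ofLp ⬝ᵥ (blockDiag d t *ᵥ x.ofLp))

/-- The feasible pairs `(t, s)` of the semidefinite program, with `t ∈ ℝⁿ` the multipliers and
`s ∈ ℝᴹ`. -/
def sdpFeasible {n M : ℕ} (d : Fin n → ℕ)
    (A : Matrix (Fin (∑ k, d k)) (Fin (∑ k, d k)) ℝ) (q : Fin (∑ k, d k) → ℝ)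
    (ξ : Fin M → Space d) : Set ((Fin n → ℝ) × (Fin M → ℝ)) :=
  {z | (∀ k, 0 ≤ z.1 k) ∧ ∀ l, (lmiMatrix d A q (ξ l) z.1 (z.2 l)).PosSemidef}

/-- The optimal value of the semidefinite program: the infimum of
`∑ₖ t_k ε_k² + ∑ₗ ϑₗ sₗ` over the feasible `(t, s)`, as an extended real number. -/
def sdpValue {n M : ℕ} (d : Fin n → ℕ)
    (A : Matrix (Fin (∑ k, d k)) (Fin (∑ k, d k)) ℝ) (q : Fin (∑ k, d k) → ℝ)
    (ε : Fin n → ℝ) (θ : Fin M → ℝ) (ξ : Fin M → Space d) : EReal :=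
  ⨅ z ∈ sdpFeasible d A q ξ, ((∑ k, z.1 k * ε k ^ 2 + ∑ l, θ l * z.2 l : ℝ) : EReal)

end

end MTH

/-! The upper bound on the worst case is weak duality. The LMI for `l` says that `h(ξ) ≤ s_l + ∑ t_k
‖ξˡ_k - ξ_k‖²` for all `ξ`, in homogenized form; integrating this against a transport plan gives
`integral_quadratic_le`.

For the converse, transport plans are relaxed to moment matrices: for each `l`, a positive
semidefinite `X l` stands for the unnormalized moments of `(ξ - ξˡ, 1)` on the mass leaving `ξˡ`.
Budgets bound summed block traces, corners equal the weights, and the objective is linear. The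
attainable data form a convex cone, closed because traces and corners control every entry of the `X
l` (`isClosed_momentCone`). Separating a point from this cone gives SDP multipliers
(`mem_momentCone_of_forall_le`), so each real `r` not exceeding the SDP value is reached by some
family `X`. No Slater condition is needed, and `ε_k = 0` is allowed.

The relaxation is exact (`exists_mem_hyperrectangle_of_mem_momentCone`). Split `X l` into rank-one
terms `(z, w)(z, w)ᵀ`. If `w ≠ 0`, the term is an atom of mass `w²` displaced by `z / w`. If `w =
0`, it is a second moment without mass; it is produced by splitting existing atoms symmetrically
along `±z`. Costs and the quadratic part of `h` do not depend on `l`, so any atoms may carry this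
spread. -/

namespace MTH

/-! ### Positive semidefinite matrices: closedness and entry bounds. -/

section PosSemidef

variable {J : Type*} [Fintype J]

theorem dotProduct_mulVec_eq_sum (X : Matrix J J ℝ) (v : J → ℝ) :
    v ⬝ᵥ (X *ᵥ v) = ∑ i, ∑ j, X i j * (v i * v j) := by
  simp only [dotProduct, Matrix.mulVec, Finset.mul_sum]
  exact Finset.sum_congr rfl fun i _ => Finset.sum_congr rfl fun j _ => by ring

theorem posSemidef_iff_sum_nonneg (X : Matrix J J ℝ) :
    X.PosSemidef ↔ X.IsSymm ∧ ∀ v : J → ℝ, 0 ≤ ∑ i, ∑ j, X i j * (v i * v j) := by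
  rw [Matrix.posSemidef_iff_dotProduct_mulVec]
  simp only [star_trivial, dotProduct_mulVec_eq_sum, Matrix.IsHermitian, Matrix.IsSymm,
    Matrix.conjTranspose_eq_transpose_of_trivial]

theorem posSemidef_vecMulVec_self (v : J → ℝ) : (Matrix.vecMulVec v v).PosSemidef := by
  simpa using Matrix.posSemidef_vecMulVec_self_star v

theorem isClosed_setOf_posSemidef : IsClosed {X : Matrix J J ℝ | X.PosSemidef} := by
  simp only [posSemidef_iff_sum_nonneg, Matrix.IsSymm, Set.ofPred_and, Set.ofPred_forall]
  refine IsClosed.inter (isClosed_eq (by fun_prop) (by fun_prop)) (isClosed_iInter fun v => ?_)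
  refine isClosed_le continuous_const ?_
  exact continuous_finsetSum _ fun i _ => continuous_finsetSum _ fun j _ =>
    (continuous_id.matrix_elem i j).mul continuous_const

theorem abs_apply_le_trace {X : Matrix J J ℝ} (hX : X.PosSemidef) (i j : J) :
    |X i j| ≤ X.trace := by
  classical
  have hnn : ∀ a, 0 ≤ X a a := fun a => hX.diag_nonneg
  have hsymm : X j i = X i j := by
    simpa using congrFun (congrFun hX.isHermitian.eq i) j
  have hle : ∀ a, X a a ≤ X.trace := fun a =>
    Finset.single_le_sum (f := fun a => X a a) (fun b _ => hnn b) (Finset.mem_univ a)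
  -- Test the form on `e_i + c e_j`; `c = ±1` gives `2 |X i j| ≤ X i i + X j j`.
  have key : ∀ c : ℝ, 0 ≤ X i i + 2 * c * X i j + c ^ 2 * X j j := by
    intro c
    have h := hX.dotProduct_mulVec_nonneg (Pi.single i 1 + c • Pi.single j 1)
    simp [Matrix.mulVec_add, Matrix.mulVec_smul, dotProduct_add, add_dotProduct, hsymm] at h
    linarith
  have h1 := key 1
  have h2 := key (-1)
  have h3 := hle i
  have h4 := hle j
  rw [abs_le]
  constructor <;> linarith

end PosSemidef

/-! ### The cone of moment data. -/

section Cone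

variable {I K L : Type*} [Fintype I] [DecidableEq K]

/-- The trace of the block of `X` consisting of the indices `i` with `blk i = k`. -/
def blockTrace (blk : I → K) (X : Matrix (I ⊕ Unit) (I ⊕ Unit) ℝ) (k : K) : ℝ :=
  ∑ i, if blk i = k then X (Sum.inl i) (Sum.inl i) else 0

/-- The entrywise pairing of two matrices. -/
def pairing (H X : Matrix (I ⊕ Unit) (I ⊕ Unit) ℝ) : ℝ := ∑ i, ∑ j, H i j * X i j

theorem blockTrace_add (blk : I → K) (X Y : Matrix (I ⊕ Unit) (I ⊕ Unit) ℝ) (k : K) :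
    blockTrace blk (X + Y) k = blockTrace blk X k + blockTrace blk Y k := by
  simp only [blockTrace, ← Finset.sum_add_distrib, Matrix.add_apply]
  exact Finset.sum_congr rfl fun i _ => by split_ifs <;> simp

theorem blockTrace_smul (blk : I → K) (c : ℝ) (X : Matrix (I ⊕ Unit) (I ⊕ Unit) ℝ) (k : K) :
    blockTrace blk (c • X) k = c * blockTrace blk X k := by
  simp [blockTrace, Finset.mul_sum]

theorem pairing_add (H X Y : Matrix (I ⊕ Unit) (I ⊕ Unit) ℝ) :
    pairing H (X + Y) = pairing H X + pairing H Y := by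
  simp [pairing, mul_add, Finset.sum_add_distrib]

theorem pairing_smul (c : ℝ) (H X : Matrix (I ⊕ Unit) (I ⊕ Unit) ℝ) :
    pairing H (c • X) = c * pairing H X := by
  simp only [pairing, Finset.mul_sum, Matrix.smul_apply, smul_eq_mul]
  exact Finset.sum_congr rfl fun i _ => Finset.sum_congr rfl fun j _ => by ring

theorem sum_blockTrace [Fintype K] (blk : I → K) (X : Matrix (I ⊕ Unit) (I ⊕ Unit) ℝ) :
    ∑ k, blockTrace blk X k + X (Sum.inr ()) (Sum.inr ()) = X.trace := by
  simp only [blockTrace]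
  rw [Finset.sum_comm]
  simp [Matrix.trace]

theorem continuous_blockTrace (blk : I → K) (k : K) :
    Continuous fun X : Matrix (I ⊕ Unit) (I ⊕ Unit) ℝ => blockTrace blk X k := by
  refine continuous_finsetSum _ fun i _ => ?_
  split_ifs
  · exact continuous_id.matrix_elem _ _
  · exact continuous_const

theorem continuous_pairing (H : Matrix (I ⊕ Unit) (I ⊕ Unit) ℝ) :
    Continuous fun X : Matrix (I ⊕ Unit) (I ⊕ Unit) ℝ => pairing H X :=
  continuous_finsetSum _ fun i _ => continuous_finsetSum _ fun j _ =>
    continuous_const.mul (continuous_id.matrix_elem i j)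

variable [Fintype L]

/-- The cone of triples `(u, w, r)` for which some family of positive semidefinite moment matrices
has block traces at most `u`, corners `w`, and objective value at least `r`. -/
def momentCone (blk : I → K) (H : L → Matrix (I ⊕ Unit) (I ⊕ Unit) ℝ) :
    Set ((K → ℝ) × (L → ℝ) × ℝ) :=
  {y | ∃ X : L → Matrix (I ⊕ Unit) (I ⊕ Unit) ℝ, (∀ l, (X l).PosSemidef) ∧
    (∀ k, ∑ l, blockTrace blk (X l) k ≤ y.1 k) ∧
    (∀ l, X l (Sum.inr ()) (Sum.inr ()) = y.2.1 l) ∧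
    y.2.2 ≤ ∑ l, pairing (H l) (X l)}

variable (blk : I → K) (H : L → Matrix (I ⊕ Unit) (I ⊕ Unit) ℝ)

theorem momentCone_add {y z : (K → ℝ) × (L → ℝ) × ℝ} (hy : y ∈ momentCone blk H)
    (hz : z ∈ momentCone blk H) : y + z ∈ momentCone blk H := by
  obtain ⟨X, hX, hX1, hX2, hX3⟩ := hy
  obtain ⟨Y, hY, hY1, hY2, hY3⟩ := hz
  refine ⟨X + Y, fun l => (hX l).add (hY l), fun k => ?_, fun l => ?_, ?_⟩
  · simpa only [Pi.add_apply, blockTrace_add, Finset.sum_add_distrib, Prod.fst_add]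
      using add_le_add (hX1 k) (hY1 k)
  · simp [hX2, hY2]
  · simpa only [Pi.add_apply, pairing_add, Finset.sum_add_distrib, Prod.snd_add]
      using add_le_add hX3 hY3

theorem momentCone_smul {y : (K → ℝ) × (L → ℝ) × ℝ} (hy : y ∈ momentCone blk H) {c : ℝ}
    (hc : 0 ≤ c) : c • y ∈ momentCone blk H := by
  obtain ⟨X, hX, hX1, hX2, hX3⟩ := hy
  refine ⟨c • X, fun l => (hX l).smul hc, fun k => ?_, fun l => ?_, ?_⟩
  · simpa only [Pi.smul_apply, blockTrace_smul, ← Finset.mul_sum, Prod.smul_fst, smul_eq_mul]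
      using mul_le_mul_of_nonneg_left (hX1 k) hc
  · simp [hX2]
  · simpa only [Pi.smul_apply, pairing_smul, ← Finset.mul_sum, Prod.smul_snd, smul_eq_mul]
      using mul_le_mul_of_nonneg_left hX3 hc

theorem convex_momentCone : Convex ℝ (momentCone blk H) := fun _ hy _ hz _ _ ha hb _ =>
  momentCone_add blk H (momentCone_smul blk H hy ha) (momentCone_smul blk H hz hb)

/-- Block traces and corners add up to the total trace, which bounds all entries of a positive
semidefinite matrix. Witnesses along a convergent sequence thus stay in a compact box, and a
subsequential limit is a witness for the limit point. -/
theorem isClosed_momentCone [Fintype K] : IsClosed (momentCone blk H) := by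
  refine IsSeqClosed.isClosed fun y y₀ hy hlim => ?_
  choose X hX h1 h2 h3 using hy
  have hl1 : ∀ k, Filter.Tendsto (fun m => (y m).1 k) Filter.atTop (nhds (y₀.1 k)) := fun k =>
    (((continuous_apply k).comp continuous_fst).tendsto y₀).comp hlim
  have hl2 : ∀ l, Filter.Tendsto (fun m => (y m).2.1 l) Filter.atTop (nhds (y₀.2.1 l)) := fun l =>
    (((continuous_apply l).comp (continuous_fst.comp continuous_snd)).tendsto y₀).comp hlim
  have hl3 : Filter.Tendsto (fun m => (y m).2.2) Filter.atTop (nhds y₀.2.2) :=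
    ((continuous_snd.comp continuous_snd).tendsto y₀).comp hlim
  have hb : Filter.Tendsto (fun m => ∑ k, (y m).1 k + ∑ l, (y m).2.1 l) Filter.atTop
      (nhds (∑ k, y₀.1 k + ∑ l, y₀.2.1 l)) :=
    (tendsto_finsetSum _ fun k _ => hl1 k).add (tendsto_finsetSum _ fun l _ => hl2 l)
  obtain ⟨R, hR⟩ := hb.bddAbove_range
  have htr : ∀ m l, (X m l).trace ≤ R := by
    intro m l
    calc (X m l).trace ≤ ∑ l, (X m l).trace :=
          Finset.single_le_sum (f := fun l => (X m l).trace)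
            (fun l _ => Finset.sum_nonneg fun i _ => (hX m l).diag_nonneg) (Finset.mem_univ l)
      _ = ∑ k, ∑ l, blockTrace blk (X m l) k + ∑ l, (y m).2.1 l := by
          simp only [← sum_blockTrace blk, Finset.sum_add_distrib, h2]
          rw [Finset.sum_comm]
      _ ≤ ∑ k, (y m).1 k + ∑ l, (y m).2.1 l :=
          add_le_add_left (Finset.sum_le_sum fun k _ => h1 m k) _
      _ ≤ R := hR ⟨m, rfl⟩
  have hcomp : IsCompact (Set.univ.pi fun _ : L => Set.univ.pi fun _ : I ⊕ Unit =>
      Set.univ.pi fun _ : I ⊕ Unit => Set.Icc (-R) R) :=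
    isCompact_univ_pi fun _ => isCompact_univ_pi fun _ => isCompact_univ_pi fun _ => isCompact_Icc
  have hmem : ∀ m, (X m : L → (I ⊕ Unit) → (I ⊕ Unit) → ℝ) ∈ (Set.univ.pi fun _ : L =>
      Set.univ.pi fun _ : I ⊕ Unit => Set.univ.pi fun _ : I ⊕ Unit => Set.Icc (-R) R) :=
    fun m l _ i _ j _ => abs_le.mp ((abs_apply_le_trace (hX m l) i j).trans (htr m l))
  obtain ⟨X₀, -, φ, hφ, hconv⟩ := hcomp.tendsto_subseq hmem
  have hXl : ∀ l, Filter.Tendsto (fun m => X (φ m) l) Filter.atTop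
      (nhds (X₀ l : Matrix (I ⊕ Unit) (I ⊕ Unit) ℝ)) := fun l =>
    ((continuous_apply l).tendsto X₀).comp hconv
  have hφ' := hφ.tendsto_atTop
  refine ⟨X₀, fun l => ?_, fun k => ?_, fun l => ?_, ?_⟩
  · exact isClosed_setOf_posSemidef.mem_of_tendsto (hXl l) (.of_forall fun m => hX _ l)
  · exact le_of_tendsto_of_tendsto'
      (tendsto_finsetSum _ fun l _ => ((continuous_blockTrace blk k).tendsto _).comp (hXl l))
      ((hl1 k).comp hφ') fun m => h1 _ k
  · exact tendsto_nhds_unique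
      (((continuous_id.matrix_elem (Sum.inr ()) (Sum.inr ())).tendsto _).comp (hXl l))
      (((hl2 l).comp hφ').congr fun m => (h2 _ l).symm)
  · exact le_of_tendsto_of_tendsto' (hl3.comp hφ')
      (tendsto_finsetSum _ fun l _ => ((continuous_pairing (H l)).tendsto _).comp (hXl l))
      fun m => h3 _

end Cone

/-! ### Conic duality by separation. -/

section Duality

variable {I K L : Type*} [Fintype I] [Fintype L] [DecidableEq K]
  (blk : I → K) (H : L → Matrix (I ⊕ Unit) (I ⊕ Unit) ℝ)

theorem apply_eq_sum_of_dual [Fintype K] [DecidableEq L] (f : StrongDual ℝ ((K → ℝ) × (L → ℝ) × ℝ))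
    (u : K → ℝ) (w : L → ℝ) (r : ℝ) :
    f (u, w, r) = ∑ k, u k * f (Pi.single k 1, 0, 0) + ∑ l, w l * f (0, Pi.single l 1, 0)
      + r * f (0, 0, 1) := by
  have h : (u, w, r) = ∑ k, u k • ((Pi.single k 1, 0, 0) : (K → ℝ) × (L → ℝ) × ℝ)
      + ∑ l, w l • ((0, Pi.single l 1, 0) : (K → ℝ) × (L → ℝ) × ℝ)
      + r • ((0, 0, 1) : (K → ℝ) × (L → ℝ) × ℝ) := by
    ext k <;> simp [Prod.fst_sum, Prod.snd_sum, Finset.sum_apply, Pi.single_apply]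
  rw [h]
  simp only [map_add, map_sum, map_smul, smul_eq_mul]

/-- These pure slack directions force the signs of the multipliers of the budgets and of the
objective. -/
theorem mem_momentCone_of_nonneg {u : K → ℝ} (hu : ∀ k, 0 ≤ u k) {r : ℝ} (hr : r ≤ 0) :
    (u, 0, r) ∈ momentCone blk H :=
  ⟨0, fun _ => Matrix.PosSemidef.zero, by simpa [blockTrace] using hu, by simp,
    by simpa [pairing] using hr⟩

theorem rankOne_mem_momentCone [DecidableEq L] (l : L) (v : I ⊕ Unit → ℝ) :
    (blockTrace blk (Matrix.vecMulVec v v), Pi.single l (v (Sum.inr ()) ^ 2),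
      pairing (H l) (Matrix.vecMulVec v v)) ∈ momentCone blk H := by
  have hb : ∀ k, blockTrace blk 0 k = 0 := fun k => by simp [blockTrace]
  have hp : ∀ l, pairing (H l) 0 = 0 := fun l => by simp [pairing]
  refine ⟨Pi.single l (Matrix.vecMulVec v v), fun l' => ?_, fun k => ?_, fun l' => ?_, ?_⟩
  · by_cases h : l' = l
    · subst h; simpa using posSemidef_vecMulVec_self v
    · simpa [h] using Matrix.PosSemidef.zero
  · rw [Finset.sum_eq_single l (fun l' _ h => by simp [h, hb]) (by simp)]
    simp
  · by_cases h : l' = l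
    · subst h; simp [Matrix.vecMulVec_apply, sq]
    · simp [h]
  · rw [Finset.sum_eq_single l (fun l' _ h => by simp [h, hp]) (by simp)]
    simp

/-- A functional separating the point from the closed cone is nonnegative on the cone. Its values on
rank-one members are the LMIs, and dividing by the objective multiplier `m` yields a dual pair whose
value is below `r`. -/
theorem mem_momentCone_of_forall_le [Fintype K] {u : K → ℝ} (hu : ∀ k, 0 ≤ u k) {w : L → ℝ}
    (hw : ∀ l, 0 ≤ w l) {r : ℝ}
    (h : ∀ (t : K → ℝ) (s : L → ℝ), (∀ k, 0 ≤ t k) →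
      (∀ l (v : I ⊕ Unit → ℝ), pairing (H l) (Matrix.vecMulVec v v) ≤
        ∑ k, t k * blockTrace blk (Matrix.vecMulVec v v) k + s l * v (Sum.inr ()) ^ 2) →
      r ≤ ∑ k, t k * u k + ∑ l, w l * s l) :
    (u, w, r) ∈ momentCone blk H := by
  classical
  by_contra hmem
  obtain ⟨f, a, hfa, hF⟩ := geometric_hahn_banach_point_closed (convex_momentCone blk H)
    (isClosed_momentCone blk H) hmem
  have ha : a < 0 := by
    simpa using hF 0 (mem_momentCone_of_nonneg blk H (fun _ => le_rfl) le_rfl)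
  have hnn : ∀ y ∈ momentCone blk H, 0 ≤ f y := by
    intro y hy
    by_contra! hneg
    -- The factor scales `y` to a point of the cone where `f` equals `a`.
    have := hF ((a / f y) • y) (momentCone_smul blk H hy (div_nonneg_of_nonpos ha.le hneg.le))
    rw [map_smul, smul_eq_mul, div_mul_cancel₀ _ hneg.ne] at this
    exact lt_irrefl _ this
  set t : K → ℝ := fun k => f (Pi.single k 1, 0, 0) with ht
  set s : L → ℝ := fun l => f (0, Pi.single l 1, 0) with hs
  set m : ℝ := - f (0, 0, 1) with hm
  have hf : ∀ u w r, f (u, w, r) = ∑ k, u k * t k + ∑ l, w l * s l - r * m := by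
    intro u w r
    rw [apply_eq_sum_of_dual, hm]
    ring
  have ht0 : ∀ k, 0 ≤ t k := fun k => hnn _ (mem_momentCone_of_nonneg blk H
    (fun j => by rw [Pi.single_apply]; split_ifs <;> norm_num) le_rfl)
  have hm0 : 0 ≤ m := by
    have := hnn _ (mem_momentCone_of_nonneg blk H (u := 0) (fun _ => le_rfl)
      (neg_nonpos.2 zero_le_one))
    rw [hf] at this
    simpa using this
  have hlmi : ∀ l (v : I ⊕ Unit → ℝ), pairing (H l) (Matrix.vecMulVec v v) * m ≤
      ∑ k, t k * blockTrace blk (Matrix.vecMulVec v v) k + s l * v (Sum.inr ()) ^ 2 := by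
    intro l v
    have := hnn _ (rankOne_mem_momentCone blk H l v)
    rw [hf] at this
    simp only [Pi.single_apply, ite_mul, zero_mul, Finset.sum_ite_eq', Finset.mem_univ,
      if_true] at this
    simp only [mul_comm (t _), mul_comm (s l)]
    linarith
  have hlt : ∑ k, u k * t k + ∑ l, w l * s l < r * m := by
    have := hfa.trans ha
    rw [hf] at this
    linarith
  -- If `m = 0`, testing on the corner vector gives `s ≥ 0`, so the functional is nonnegative at the
  -- point and cannot separate it.
  rcases hm0.eq_or_lt with hm0 | hm0
  · have hs0 : ∀ l, 0 ≤ s l := fun l => by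
      have := hlmi l (Pi.single (Sum.inr ()) 1)
      simpa [← hm0, blockTrace, Matrix.vecMulVec_apply] using this
    have h1 : 0 ≤ ∑ k, u k * t k := Finset.sum_nonneg fun k _ => mul_nonneg (hu k) (ht0 k)
    have h2 : 0 ≤ ∑ l, w l * s l := Finset.sum_nonneg fun l _ => mul_nonneg (hw l) (hs0 l)
    rw [← hm0] at hlt
    linarith
  · have := h (fun k => t k / m) (fun l => s l / m) (fun k => div_nonneg (ht0 k) hm0.le) (by
      intro l v
      have := (le_div_iff₀ hm0).2 (hlmi l v)
      simpa only [add_div, Finset.sum_div, div_mul_eq_mul_div] using this)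
    have h3 := (mul_le_mul_iff_of_pos_right hm0).2 this
    have h4 : (∑ k, t k / m * u k + ∑ l, w l * (s l / m)) * m
        = ∑ k, u k * t k + ∑ l, w l * s l := by
      rw [add_mul, Finset.sum_mul, Finset.sum_mul]
      congr 1
      · exact Finset.sum_congr rfl fun k _ => by field_simp
      · exact Finset.sum_congr rfl fun k _ => by field_simp
    linarith

end Duality

-- With `B` the self-adjoint square root, `X = BᵀB` is the sum of the outer squares of the rows of
-- `B`.
open scoped MatrixOrder in
theorem exists_eq_sum_vecMulVec {J : Type*} [Fintype J] {X : Matrix J J ℝ} (hX : X.PosSemidef) :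
    ∃ y : J → J → ℝ, X = ∑ j, Matrix.vecMulVec (y j) (y j) := by
  classical
  obtain ⟨B, hB, -, rfl⟩ := CFC.exists_sqrt_of_isSelfAdjoint_of_quasispectrumRestricts
    hX.isHermitian (QuasispectrumRestricts.nnreal_of_nonneg hX.nonneg)
  refine ⟨B, ?_⟩
  nth_rw 1 [← hB.star_eq]
  ext i j
  simp [Matrix.mul_apply, Matrix.sum_apply, Matrix.vecMulVec_apply, Matrix.star_eq_conjTranspose]

/-! ### Bordered matrices and homogenized quadratic polynomials. -/

section Bordered

variable {I K : Type*} [Fintype I]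

/-- The symmetric matrix `[A, b; bᵀ, c]`. -/
def bordered (A : Matrix I I ℝ) (b : I → ℝ) (c : ℝ) : Matrix (I ⊕ Unit) (I ⊕ Unit) ℝ :=
  Matrix.fromBlocks A (Matrix.replicateCol Unit b) (Matrix.replicateRow Unit b)
    (Matrix.of fun _ _ => c)

theorem pairing_bordered (A : Matrix I I ℝ) (b : I → ℝ) (c : ℝ) (x : I → ℝ) (t : ℝ) :
    pairing (bordered A b c) (Matrix.vecMulVec (Sum.elim x fun _ => t) (Sum.elim x fun _ => t))
      = x ⬝ᵥ (A *ᵥ x) + 2 * t * (b ⬝ᵥ x) + c * t ^ 2 := by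
  rw [dotProduct_mulVec_eq_sum]
  simp only [pairing, bordered, Fintype.sum_sum_type, Matrix.vecMulVec_apply, dotProduct]
  simp [Finset.sum_add_distrib, Finset.mul_sum]
  rw [two_mul, add_assoc, add_assoc]
  congr 1
  have h1 : ∑ i, b i * (x i * t) = ∑ i, t * (b i * x i) :=
    Finset.sum_congr rfl fun i _ => by ring
  have h2 : ∑ i, b i * (t * x i) = ∑ i, t * (b i * x i) :=
    Finset.sum_congr rfl fun i _ => by ring
  rw [h1, h2, ← add_assoc, ← Finset.sum_add_distrib]
  congr 1
  · exact Finset.sum_congr rfl fun i _ => by ring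
  · ring

theorem dotProduct_mulVec_comm {A : Matrix I I ℝ} (hA : A.IsSymm) (x y : I → ℝ) :
    x ⬝ᵥ (A *ᵥ y) = y ⬝ᵥ (A *ᵥ x) := by
  rw [Matrix.dotProduct_mulVec, ← Matrix.mulVec_transpose, hA.eq, dotProduct_comm]

theorem posSemidef_bordered_iff {A : Matrix I I ℝ} (hA : A.IsSymm) (b : I → ℝ) (c : ℝ) :
    (bordered A b c).PosSemidef ↔
      ∀ (x : I → ℝ) (t : ℝ), 0 ≤ x ⬝ᵥ (A *ᵥ x) + 2 * t * (b ⬝ᵥ x) + c * t ^ 2 := by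
  have hsymm : (bordered A b c).IsSymm := by
    simp only [Matrix.IsSymm, bordered, Matrix.fromBlocks_transpose, hA.eq,
      Matrix.transpose_replicateCol, Matrix.transpose_replicateRow]
    rfl
  rw [posSemidef_iff_sum_nonneg]
  constructor
  · intro h x t
    rw [← pairing_bordered]
    exact h.2 _
  · refine fun h => ⟨hsymm, fun v => ?_⟩
    have hv : v = Sum.elim (fun i => v (Sum.inl i)) fun _ => v (Sum.inr ()) := by
      ext (i | i) <;> rfl
    rw [hv]
    have := h (fun i => v (Sum.inl i)) (v (Sum.inr ()))
    rw [← pairing_bordered] at this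
    exact this

theorem blockTrace_vecMulVec [DecidableEq K] (blk : I → K) (x : I → ℝ) (t : ℝ) (k : K) :
    blockTrace blk (Matrix.vecMulVec (Sum.elim x fun _ => t) (Sum.elim x fun _ => t)) k
      = ∑ i, if blk i = k then x i ^ 2 else 0 := by
  simp [blockTrace, Matrix.vecMulVec_apply, sq]

end Bordered

/-! ### The LMI as a quadratic inequality. -/

section Quadratic

variable {n : ℕ} (d : Fin n → ℕ)

theorem dotProduct_blockDiag_mulVec (t : Fin n → ℝ) (x : Fin (∑ k, d k) → ℝ) :
    x ⬝ᵥ (blockDiag d t *ᵥ x) = ∑ k, t k * ∑ i, if blockOf d i = k then x i ^ 2 else 0 := by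
  simp only [Finset.mul_sum]
  rw [Finset.sum_comm]
  simp only [blockDiag, Matrix.mulVec_diagonal, dotProduct, mul_ite, mul_zero, Finset.sum_ite_eq,
    Finset.mem_univ, if_true]
  exact Finset.sum_congr rfl fun i _ => by ring

theorem norm_component_sq (k : Fin n) (x : Space d) :
    ‖component d k x‖ ^ 2 = ∑ i, if blockOf d i = k then x i ^ 2 else 0 := by
  rw [EuclideanSpace.norm_sq_eq, ← finSigmaFinEquiv.sum_comp, Fintype.sum_sigma,
    Finset.sum_eq_single k]
  · simp [blockOf, component, blockIndex]
  · intro j _ hj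
    simp [blockOf, hj]
  · simp

theorem component_sub (k : Fin n) (x y : Space d) :
    component d k (x - y) = component d k x - component d k y := by
  ext j; simp [component]

variable (A : Matrix (Fin (∑ k, d k)) (Fin (∑ k, d k)) ℝ) (q : Fin (∑ k, d k) → ℝ)

theorem isSymm_blockDiag (t : Fin n → ℝ) : (blockDiag d t).IsSymm := by
  simp [blockDiag, Matrix.IsSymm]

theorem lmiMatrix_eq_bordered (x : Space d) (t : Fin n → ℝ) (s : ℝ) :
    lmiMatrix d A q x t s = bordered (blockDiag d t - A) (q + blockDiag d t *ᵥ x.ofLp)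
      (s + x.ofLp ⬝ᵥ (blockDiag d t *ᵥ x.ofLp)) := by
  have h : x.ofLp ᵥ* blockDiag d t = blockDiag d t *ᵥ x.ofLp := by
    rw [← Matrix.mulVec_transpose, (isSymm_blockDiag d t).eq]
  rw [lmiMatrix, h, bordered]

/-- The symmetric matrix of the homogenization of `z ↦ h(x + z)`. -/
def shiftedMatrix (x : Space d) :
    Matrix (Fin (∑ k, d k) ⊕ Unit) (Fin (∑ k, d k) ⊕ Unit) ℝ :=
  bordered A (A *ᵥ x.ofLp + q) (quadratic d A q x)

variable {A}

theorem quadratic_add (hA : A.IsSymm) (x z : Space d) :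
    quadratic d A q (x + z) = z.ofLp ⬝ᵥ (A *ᵥ z.ofLp)
      + 2 * ((A *ᵥ x.ofLp + q) ⬝ᵥ z.ofLp) + quadratic d A q x := by
  simp only [quadratic, WithLp.ofLp_add, Matrix.mulVec_add, dotProduct_add, add_dotProduct,
    dotProduct_mulVec_comm hA x.ofLp z.ofLp, dotProduct_comm (A *ᵥ x.ofLp) z.ofLp]
  ring

/-- The invertible substitution `(z, w) ↦ (z + w x, -w)` recentres the form at the atom `x`. The
sign flip compensates for the positive sign of `q` in the border. -/
theorem posSemidef_lmiMatrix_iff (hA : A.IsSymm) (x : Space d) (t : Fin n → ℝ) (s : ℝ) :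
    (lmiMatrix d A q x t s).PosSemidef ↔ ∀ (z : Fin (∑ k, d k) → ℝ) (w : ℝ),
      z ⬝ᵥ (A *ᵥ z) + 2 * w * ((A *ᵥ x.ofLp + q) ⬝ᵥ z) + quadratic d A q x * w ^ 2
        ≤ z ⬝ᵥ (blockDiag d t *ᵥ z) + s * w ^ 2 := by
  have hD := isSymm_blockDiag d t
  rw [lmiMatrix_eq_bordered, posSemidef_bordered_iff (hD.sub hA)]
  have key : ∀ (z : Fin (∑ k, d k) → ℝ) (w : ℝ),
      (z + w • x.ofLp) ⬝ᵥ ((blockDiag d t - A) *ᵥ (z + w • x.ofLp))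
        + 2 * (-w) * ((q + blockDiag d t *ᵥ x.ofLp) ⬝ᵥ (z + w • x.ofLp))
        + (s + x.ofLp ⬝ᵥ (blockDiag d t *ᵥ x.ofLp)) * (-w) ^ 2
      = z ⬝ᵥ (blockDiag d t *ᵥ z) + s * w ^ 2 -
        (z ⬝ᵥ (A *ᵥ z) + 2 * w * ((A *ᵥ x.ofLp + q) ⬝ᵥ z) + quadratic d A q x * w ^ 2) := by
    intro z w
    simp only [quadratic, Matrix.mulVec_add, Matrix.sub_mulVec, Matrix.mulVec_smul, dotProduct_add,
      add_dotProduct, dotProduct_sub, dotProduct_smul, smul_dotProduct, smul_eq_mul,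
      dotProduct_mulVec_comm hA x.ofLp z, dotProduct_mulVec_comm hD x.ofLp z,
      dotProduct_comm (A *ᵥ x.ofLp) z, dotProduct_comm (blockDiag d t *ᵥ x.ofLp) _]
    ring
  constructor
  · intro h z w
    have := h (z + w • x.ofLp) (-w)
    rw [key] at this
    linarith
  · intro h z t'
    have := h (z + t' • x.ofLp) (-t')
    have hk := key (z + t' • x.ofLp) (-t')
    rw [neg_smul, add_neg_cancel_right, neg_neg] at hk
    rw [hk]
    linarith

end Quadratic

/-! ### Splitting atoms to realize massless second moments. -/

section Atoms

variable {V L α : Type*} [AddCommGroup V] [Module ℝ V] [Fintype α]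

/-- The vector `z b` if its weight `w b` vanishes, and zero otherwise. -/
noncomputable def escaping (z : α → V) (w : α → ℝ) (b : α) : V :=
  open Classical in if w b = 0 then z b else 0

/-- The displacement of the atom with label `(a, b, σ)`. -/
noncomputable def displacement (z : α → V) (w : α → ℝ) (a : α × α × Bool) : V :=
  (w a.1)⁻¹ • z a.1 + (bif a.2.2 then √(Fintype.card α) else -√(Fintype.card α)) •
    escaping z w a.2.1

/-- The weight of the atom with label `(a, b, σ)`. -/
noncomputable def atomWeight (w : α → ℝ) (a : α × α × Bool) : ℝ :=
  w a.1 ^ 2 / (2 * Fintype.card α)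

theorem atomWeight_nonneg (w : α → ℝ) (a : α × α × Bool) : 0 ≤ atomWeight w a := by
  unfold atomWeight
  positivity

theorem sum_atomWeight_mul [Nonempty α] (w : α → ℝ) (f : α → ℝ) :
    ∑ a, atomWeight w a * f a.1 = ∑ a, w a ^ 2 * f a := by
  have hN : (Fintype.card α : ℝ) ≠ 0 := by simp
  simp only [Fintype.sum_prod_type, atomWeight, Fintype.sum_bool]
  refine Finset.sum_congr rfl fun a _ => ?_
  simp only [Finset.sum_const, Finset.card_univ, nsmul_eq_mul]
  field_simp
  ring

/-- Here `g l` is quadratic with leading part `B` (`hg` is the parallelogram identity) and `G l` is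
its homogenization. Let `N = card α`. The step `±√N z_b` carried by mass `w_a² / N` contributes
`w_a² B(z_b)`, and `∑ w_a² = 1` turns the sum over `a` into `B(z_b)`. Labels with `w_a = 0` have no
weight, so the value of `(w a)⁻¹` there is immaterial. -/
theorem sum_atomWeight_mul_quadratic [Nonempty α] (z : α → V) (w : α → ℝ)
    (hw : ∑ a, w a ^ 2 = 1) (lab : α → L) (g : L → V → ℝ) (B : V → ℝ) (G : L → V → ℝ → ℝ)
    (hg : ∀ l x c, g l (x + c) + g l (x - c) = 2 * g l x + 2 * B c)
    (hB : ∀ (r : ℝ) c, B (r • c) = r ^ 2 * B c)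
    (hG : ∀ l x (r : ℝ), r ≠ 0 → r ^ 2 * g l (r⁻¹ • x) = G l x r)
    (hG0 : ∀ l x, G l x 0 = B x) :
    ∑ a, atomWeight w a * g (lab a.1) (displacement z w a) = ∑ a, G (lab a) (z a) (w a) := by
  have hN : (Fintype.card α : ℝ) ≠ 0 := by simp
  have hB0 : B 0 = 0 := by simpa using hB 0 0
  -- The two signs cancel the cross term, leaving the value at the centre plus the leading part of
  -- the step.
  have h1 : ∀ a b, ∑ σ, atomWeight w (a, b, σ) * g (lab a) (displacement z w (a, b, σ))
      = w a ^ 2 * g (lab a) ((w a)⁻¹ • z a) / Fintype.card α + w a ^ 2 * B (escaping z w b) := by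
    intro a b
    have := hg (lab a) ((w a)⁻¹ • z a) (√(Fintype.card α) • escaping z w b)
    rw [hB, Real.sq_sqrt (Nat.cast_nonneg _)] at this
    simp only [Fintype.sum_bool, atomWeight, displacement, cond_true, cond_false, neg_smul,
      ← sub_eq_add_neg]
    rw [← mul_add, this]
    field_simp
  have h2 : ∀ a, w a ^ 2 * g (lab a) ((w a)⁻¹ • z a) + B (escaping z w a)
      = G (lab a) (z a) (w a) := by
    intro a
    by_cases h : w a = 0
    · simp [h, escaping, hG0]
    · simp [h, escaping, hB0, hG]
  simp only [Fintype.sum_prod_type]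
  simp only [h1, ← h2, Finset.sum_add_distrib, Finset.sum_const, Finset.card_univ, nsmul_eq_mul,
    ← Finset.mul_sum]
  rw [← Finset.sum_mul, hw, one_mul, Finset.mul_sum]
  congr 1
  exact Finset.sum_congr rfl fun a _ => by field_simp

end Atoms

/-! ### Finitely supported measures. -/

section DiracSum

variable {α Ω Ω' : Type*} [Fintype α] [MeasurableSpace Ω] [MeasurableSpace Ω']

/-- The finitely supported measure with atoms `x a` of weights `p a`. -/
noncomputable def diracSum (p : α → ℝ) (x : α → Ω) : Measure Ω :=
  ∑ a, ENNReal.ofReal (p a) • Measure.dirac (x a)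

theorem lintegral_diracSum [MeasurableSingletonClass Ω] (p : α → ℝ) (x : α → Ω) (f : Ω → ℝ≥0∞) :
    ∫⁻ y, f y ∂diracSum p x = ∑ a, ENNReal.ofReal (p a) * f (x a) := by
  simp [diracSum, lintegral_finsetSum_measure]

theorem integrable_diracSum [MeasurableSingletonClass Ω] (p : α → ℝ) (x : α → Ω) (f : Ω → ℝ) :
    Integrable f (diracSum p x) :=
  integrable_finsetSum_measure.2 fun _ _ =>
    (integrable_dirac (by simp)).smul_measure ENNReal.ofReal_ne_top

theorem integral_diracSum [MeasurableSingletonClass Ω] {p : α → ℝ} (hp : ∀ a, 0 ≤ p a)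
    (x : α → Ω) (f : Ω → ℝ) : ∫ y, f y ∂diracSum p x = ∑ a, p a * f (x a) := by
  rw [diracSum, integral_finsetSum_measure fun _ _ =>
    (integrable_dirac (by simp)).smul_measure ENNReal.ofReal_ne_top]
  simp [integral_smul_measure, ENNReal.toReal_ofReal, hp]

theorem diracSum_apply {p : α → ℝ} (hp : ∀ a, 0 ≤ p a) (x : α → Ω) {s : Set Ω}
    (hs : MeasurableSet s) :
    diracSum p x s = ENNReal.ofReal (∑ a, p a * s.indicator 1 (x a)) := by
  rw [ENNReal.ofReal_sum_of_nonneg fun a _ =>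
    mul_nonneg (hp a) (Set.indicator_nonneg (f := (1 : Ω → ℝ)) (fun _ _ => zero_le_one) _)]
  simp only [diracSum, Measure.coe_finsetSum, Finset.sum_apply, Measure.smul_apply,
    Measure.dirac_apply' _ hs, smul_eq_mul]
  refine Finset.sum_congr rfl fun a _ => ?_
  rw [ENNReal.ofReal_mul (hp a)]
  by_cases h : x a ∈ s <;> simp [h]

theorem map_diracSum {p : α → ℝ} (hp : ∀ a, 0 ≤ p a) (x : α → Ω) {f : Ω → Ω'}
    (hf : Measurable f) : (diracSum p x).map f = diracSum p (f ∘ x) := by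
  ext s hs
  rw [Measure.map_apply hf hs, diracSum_apply hp _ (hf hs), diracSum_apply hp _ hs]
  rfl

theorem isProbabilityMeasure_diracSum {p : α → ℝ} (hp : ∀ a, 0 ≤ p a) (hp1 : ∑ a, p a = 1)
    (x : α → Ω) : IsProbabilityMeasure (diracSum p x) :=
  ⟨by rw [diracSum_apply hp _ .univ]; simp [hp1]⟩

theorem ae_diracSum_mem_range [MeasurableSingletonClass Ω] {p : α → ℝ} (hp : ∀ a, 0 ≤ p a)
    (x : α → Ω) : ∀ᵐ y ∂diracSum p x, y ∈ Set.range x := by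
  have hs : MeasurableSet (Set.range x)ᶜ := (Set.finite_range x).measurableSet.compl
  rw [ae_iff]
  refine (diracSum_apply hp x hs).trans ?_
  simp

end DiracSum

/-! ### From moment matrices to transport plans. -/

section Realization

theorem pairing_sum {I J : Type*} [Fintype I] [Fintype J]
    (H : Matrix (I ⊕ Unit) (I ⊕ Unit) ℝ) (X : J → Matrix (I ⊕ Unit) (I ⊕ Unit) ℝ) :
    pairing H (∑ j, X j) = ∑ j, pairing H (X j) := by
  simp only [pairing, Matrix.sum_apply, Finset.mul_sum]
  rw [Finset.sum_comm (s := (Finset.univ : Finset J))]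
  exact Finset.sum_congr rfl fun i _ => Finset.sum_comm

variable {n M : ℕ} (d : Fin n → ℕ) {A : Matrix (Fin (∑ k, d k)) (Fin (∑ k, d k)) ℝ}
  (q : Fin (∑ k, d k) → ℝ) {ε : Fin n → ℝ} {θ : Fin M → ℝ} (ξ : Fin M → Space d)

theorem edist_component_rpow (k : Fin n) (x y : Space d) :
    edist (component d k x) (component d k y) ^ (2 : ℝ)
      = ENNReal.ofReal (‖component d k (x - y)‖ ^ 2) := by
  rw [edist_dist, dist_eq_norm, ← component_sub,
    ENNReal.ofReal_rpow_of_nonneg (norm_nonneg _) zero_le_two, Real.rpow_two]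

theorem quadratic_add_add_quadratic_sub (hA : A.IsSymm) (ζ x c : Space d) :
    quadratic d A q (ζ + (x + c)) + quadratic d A q (ζ + (x - c))
      = 2 * quadratic d A q (ζ + x) + 2 * (c.ofLp ⬝ᵥ (A *ᵥ c.ofLp)) := by
  rw [← add_assoc, ← add_sub_assoc, sub_eq_add_neg, quadratic_add d q hA _ c,
    quadratic_add d q hA _ (-c)]
  simp only [WithLp.ofLp_neg, Matrix.mulVec_neg, dotProduct_neg, neg_dotProduct]
  ring

theorem sq_mul_quadratic_add_inv_smul (hA : A.IsSymm) (ζ x : Space d) {r : ℝ} (hr : r ≠ 0) :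
    r ^ 2 * quadratic d A q (ζ + r⁻¹ • x) = x.ofLp ⬝ᵥ (A *ᵥ x.ofLp)
      + 2 * r * ((A *ᵥ ζ.ofLp + q) ⬝ᵥ x.ofLp) + quadratic d A q ζ * r ^ 2 := by
  rw [quadratic_add d q hA]
  simp only [WithLp.ofLp_smul, Matrix.mulVec_smul, dotProduct_smul, smul_dotProduct, smul_eq_mul]
  field_simp

/-- The split-atom identity is used twice: with `g` the squared block norm it returns the block
traces, with `g` the shifted objective it returns the pairings. Both are exact, so no limit of plans
is needed. -/
theorem exists_mem_hyperrectangle_of_mem_momentCone (hA : A.IsSymm) (hε : ∀ k, 0 ≤ ε k)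
    (hθ : ∀ l, 0 ≤ θ l) (hθ_sum : ∑ l, θ l = 1) {r : ℝ}
    (h : (fun k => ε k ^ 2, θ, r) ∈ momentCone (blockOf d) fun l => shiftedMatrix d A q (ξ l)) :
    ∃ P ∈ hyperrectangle d 2 (discrete d θ ξ) ε, r ≤ ∫ x, quadratic d A q x ∂P := by
  obtain ⟨X, hX, h1, h2, h3⟩ := h
  choose y hy using fun l => exists_eq_sum_vecMulVec (hX l)
  set α := Fin M × (Fin (∑ k, d k) ⊕ Unit)
  let w : α → ℝ := fun a => y a.1 a.2 (Sum.inr ())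
  let z : α → Space d := fun a => WithLp.toLp 2 fun i => y a.1 a.2 (Sum.inl i)
  have hzw : ∀ l j, y l j = Sum.elim (z (l, j)).ofLp fun _ => w (l, j) := by
    intro l j
    ext (i | i) <;> rfl
  -- The corner of `X l` is the mass leaving `ξ l`; this yields the first marginal.
  have hcorner : ∀ l, ∑ j, w (l, j) ^ 2 = θ l := by
    intro l
    rw [← show _ = θ l from h2 l, hy l]
    simp [Matrix.sum_apply, Matrix.vecMulVec_apply, w, sq]
  have hw : ∑ a, w a ^ 2 = 1 := by
    rw [Fintype.sum_prod_type]
    simp only [hcorner, hθ_sum]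
  have hα : Nonempty α := by
    by_contra hne
    rw [not_nonempty_iff] at hne
    simp at hw
  let p : α × α × Bool → ℝ := atomWeight w
  have hp : ∀ a, 0 ≤ p a := atomWeight_nonneg w
  have hp1 : ∑ a, p a = 1 := by
    simpa [hw] using sum_atomWeight_mul w fun _ => 1
  let x : α × α × Bool → Space d × Space d := fun a => (ξ a.1.1, ξ a.1.1 + displacement z w a)
  refine ⟨(diracSum p x).map Prod.snd, ⟨diracSum p x, isProbabilityMeasure_diracSum hp hp1 x,
    ?_, fun k => ?_, rfl⟩, ?_⟩
  · rw [map_diracSum hp _ measurable_fst]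
    change _ = diracSum θ ξ
    ext s hs
    rw [diracSum_apply hp _ hs, diracSum_apply hθ _ hs]
    refine congrArg _ ((sum_atomWeight_mul w fun a => s.indicator 1 (ξ a.1)).trans ?_)
    rw [Fintype.sum_prod_type]
    simp only [← Finset.sum_mul, hcorner]
  · have hsum := sum_atomWeight_mul_quadratic z w hw Prod.fst
      (fun _ v => ‖component d k v‖ ^ 2) (fun v => ‖component d k v‖ ^ 2)
      (fun _ v _ => ‖component d k v‖ ^ 2)
      (fun _ v c => by
        simp only [norm_component_sq, Finset.mul_sum, ← Finset.sum_add_distrib]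
        refine Finset.sum_congr rfl fun i _ => ?_
        split_ifs
        · simp only [PiLp.add_apply, PiLp.sub_apply]; ring
        · simp)
      (fun r c => by
        simp only [norm_component_sq, Finset.mul_sum]
        refine Finset.sum_congr rfl fun i _ => ?_
        split_ifs
        · simp only [PiLp.smul_apply, smul_eq_mul]; ring
        · simp)
      (fun _ v r hr => by
        simp only [norm_component_sq, Finset.mul_sum]
        refine Finset.sum_congr rfl fun i _ => ?_
        split_ifs
        · simp only [PiLp.smul_apply, smul_eq_mul]; field_simp
        · simp)
      (fun _ _ => rfl)
    have hcost : ∑ a, ‖component d k (z a)‖ ^ 2 ≤ ε k ^ 2 := by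
      refine le_of_eq_of_le ?_ (h1 k)
      rw [Fintype.sum_prod_type]
      refine Finset.sum_congr rfl fun l _ => ?_
      rw [hy l]
      have : ∀ j, ‖component d k (z (l, j))‖ ^ 2
          = blockTrace (blockOf d) (Matrix.vecMulVec (y l j) (y l j)) k := by
        intro j
        rw [hzw, blockTrace_vecMulVec, norm_component_sq]
      simp only [this, blockTrace, Matrix.sum_apply]
      rw [Finset.sum_comm]
      refine Finset.sum_congr rfl fun i _ => ?_
      split_ifs <;> simp
    rw [lintegral_diracSum, ENNReal.ofReal_rpow_of_nonneg (hε k) zero_le_two, Real.rpow_two]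
    simp only [edist_component_rpow, ← ENNReal.ofReal_mul (hp _)]
    rw [← ENNReal.ofReal_sum_of_nonneg fun a _ => mul_nonneg (hp a) (sq_nonneg _)]
    refine ENNReal.ofReal_le_ofReal (le_of_eq_of_le ?_ hcost)
    rw [← hsum]
    refine Finset.sum_congr rfl fun a _ => ?_
    have : (x a).1 - (x a).2 = -displacement z w a := by simp [x]
    rw [this, norm_component_sq, norm_component_sq]
    simp [p]
  · rw [map_diracSum hp _ measurable_snd, integral_diracSum hp]
    have hsum := sum_atomWeight_mul_quadratic z w hw Prod.fst
      (fun l v => quadratic d A q (ξ l + v)) (fun v => v.ofLp ⬝ᵥ (A *ᵥ v.ofLp))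
      (fun l v r => v.ofLp ⬝ᵥ (A *ᵥ v.ofLp) + 2 * r * ((A *ᵥ (ξ l).ofLp + q) ⬝ᵥ v.ofLp)
        + quadratic d A q (ξ l) * r ^ 2)
      (fun l v c => quadratic_add_add_quadratic_sub d q hA _ _ _)
      (fun r c => by simp [Matrix.mulVec_smul, sq, mul_assoc])
      (fun l v r hr => sq_mul_quadratic_add_inv_smul d q hA _ _ hr)
      (fun _ _ => by simp)
    refine h3.trans_eq (Eq.trans ?_ hsum.symm)
    rw [Fintype.sum_prod_type]
    refine Finset.sum_congr rfl fun l _ => ?_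
    have : ∀ j, (z (l, j)).ofLp ⬝ᵥ (A *ᵥ (z (l, j)).ofLp)
        + 2 * w (l, j) * ((A *ᵥ (ξ l).ofLp + q) ⬝ᵥ (z (l, j)).ofLp)
        + quadratic d A q (ξ l) * w (l, j) ^ 2
        = pairing (shiftedMatrix d A q (ξ l)) (Matrix.vecMulVec (y l j) (y l j)) := by
      intro j
      rw [hzw, shiftedMatrix, pairing_bordered]
    simp only [this]
    rw [hy l]
    rw [pairing_sum]

end Realization

/-! ### Integrability and weak duality. -/

section WeakDuality

variable {n M : ℕ} (d : Fin n → ℕ) {A : Matrix (Fin (∑ k, d k)) (Fin (∑ k, d k)) ℝ}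
  (q : Fin (∑ k, d k) → ℝ) {ε : Fin n → ℝ} {θ : Fin M → ℝ} (ξ : Fin M → Space d)
  {π : Measure (Space d × Space d)}

theorem continuous_norm_component_sub_sq (k : Fin n) :
    Continuous fun z : Space d × Space d => ‖component d k (z.1 - z.2)‖ ^ 2 := by
  simp only [norm_component_sq]
  refine continuous_finsetSum _ fun i _ => ?_
  split_ifs
  · simp only [PiLp.sub_apply]; fun_prop
  · exact continuous_const

theorem integrable_cost (k : Fin n)
    (hk : ∫⁻ z, edist (component d k z.1) (component d k z.2) ^ (2 : ℝ) ∂π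
      ≤ ENNReal.ofReal (ε k) ^ (2 : ℝ)) :
    Integrable (fun z => ‖component d k (z.1 - z.2)‖ ^ 2) π := by
  refine ⟨(continuous_norm_component_sub_sq d k).aestronglyMeasurable, ?_⟩
  rw [hasFiniteIntegral_iff_ofReal (.of_forall fun z => sq_nonneg _)]
  simp only [edist_component_rpow] at hk
  exact hk.trans_lt (ENNReal.rpow_lt_top_of_nonneg zero_le_two ENNReal.ofReal_ne_top)

theorem integral_cost_le (k : Fin n) (hεk : 0 ≤ ε k)
    (hk : ∫⁻ z, edist (component d k z.1) (component d k z.2) ^ (2 : ℝ) ∂π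
      ≤ ENNReal.ofReal (ε k) ^ (2 : ℝ)) :
    ∫ z, ‖component d k (z.1 - z.2)‖ ^ 2 ∂π ≤ ε k ^ 2 := by
  rw [integral_eq_lintegral_of_nonneg_ae (.of_forall fun z => sq_nonneg _)
    (continuous_norm_component_sub_sq d k).aestronglyMeasurable]
  simp only [edist_component_rpow] at hk
  rw [ENNReal.ofReal_rpow_of_nonneg hεk zero_le_two, Real.rpow_two] at hk
  exact ENNReal.toReal_le_of_le_ofReal (sq_nonneg _) hk

/-- Write the coordinate as `z.1 i - (z.1 i - z.2 i)`: the first term has finitely supported law,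
the second is square integrable by the budget of its block. -/
theorem memLp_two_snd_apply (hπ : π.map Prod.fst = diracSum θ ξ)
    (hc : ∀ k, ∫⁻ z, edist (component d k z.1) (component d k z.2) ^ (2 : ℝ) ∂π
      ≤ ENNReal.ofReal (ε k) ^ (2 : ℝ)) (i : Fin (∑ k, d k)) :
    MemLp (fun z : Space d × Space d => z.2 i) 2 π := by
  have h1 : MemLp (fun x : Space d => x i) 2 (π.map Prod.fst) := by
    rw [hπ, memLp_two_iff_integrable_sq (by fun_prop)]
    exact integrable_diracSum _ _ _
  have h2 : MemLp (fun z : Space d × Space d => z.1 i) 2 π :=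
    h1.comp_of_map measurable_fst.aemeasurable
  have h3 : MemLp (fun z : Space d × Space d => z.1 i - z.2 i) 2 π := by
    rw [memLp_two_iff_integrable_sq (by fun_prop)]
    refine (integrable_cost d (blockOf d i) (hc _)).mono' (by fun_prop) (.of_forall fun z => ?_)
    rw [norm_component_sq, Real.norm_of_nonneg (sq_nonneg _)]
    have := Finset.single_le_sum
      (f := fun j => if blockOf d j = blockOf d i then (z.1 - z.2) j ^ 2 else 0)
      (fun j _ => by positivity) (Finset.mem_univ i)
    simpa using this
  exact (h2.sub h3).ae_eq (.of_forall fun z => sub_sub_cancel (z.1 i) (z.2 i))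

theorem integrable_quadratic {μ : Measure (Space d)} [IsFiniteMeasure μ]
    (h : ∀ i, MemLp (fun x : Space d => x i) 2 μ) : Integrable (quadratic d A q) μ := by
  have : quadratic d A q = fun x : Space d =>
      ∑ i, ∑ j, A i j * (x i * x j) + 2 * ∑ i, q i * x i := by
    ext x
    rw [quadratic, dotProduct_mulVec_eq_sum]
    rfl
  rw [this]
  refine (integrable_finsetSum _ fun i _ => integrable_finsetSum _ fun j _ => ?_).add
    ((integrable_finsetSum _ fun i _ => ?_).const_mul 2)
  · exact ((h i).integrable_mul (h j)).const_mul _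
  · exact ((h i).integrable one_le_two).const_mul _

theorem integrable_quadratic_of_mem_hyperrectangle {P : Measure (Space d)}
    (hP : P ∈ hyperrectangle d 2 (discrete d θ ξ) ε) : Integrable (quadratic d A q) P := by
  obtain ⟨π, hprob, hfst, hc, rfl⟩ := hP
  have : IsProbabilityMeasure (π.map (Prod.snd : Space d × Space d → Space d)) :=
    Measure.isProbabilityMeasure_map measurable_snd.aemeasurable
  refine integrable_quadratic d q fun i => ?_
  rw [memLp_map_measure_iff (by fun_prop) measurable_snd.aemeasurable]
  exact memLp_two_snd_apply d ξ hfst hc i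

theorem quadratic_le_of_posSemidef (hA : A.IsSymm) {ζ : Space d} {t : Fin n → ℝ} {s : ℝ}
    (h : (lmiMatrix d A q ζ t s).PosSemidef) (x : Space d) :
    quadratic d A q x ≤ s + ∑ k, t k * ‖component d k (ζ - x)‖ ^ 2 := by
  have := (posSemidef_lmiMatrix_iff d q hA ζ t s).1 h (x - ζ).ofLp 1
  rw [dotProduct_blockDiag_mulVec, mul_one, one_pow, mul_one, mul_one, ← quadratic_add d q hA,
    add_sub_cancel, add_comm] at this
  refine this.trans_eq (congrArg _ (Finset.sum_congr rfl fun k _ => ?_))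
  rw [norm_component_sq]
  refine congrArg _ (Finset.sum_congr rfl fun i _ => ?_)
  simp only [WithLp.ofLp_sub, Pi.sub_apply, sub_sq_comm]

theorem integral_quadratic_le (hA : A.IsSymm) (hε : ∀ k, 0 ≤ ε k) (hθ : ∀ l, 0 ≤ θ l)
    {P : Measure (Space d)} (hP : P ∈ hyperrectangle d 2 (discrete d θ ξ) ε)
    {z : (Fin n → ℝ) × (Fin M → ℝ)} (hz : z ∈ sdpFeasible d A q ξ) :
    ∫ x, quadratic d A q x ∂P ≤ ∑ k, z.1 k * ε k ^ 2 + ∑ l, θ l * z.2 l := by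
  have hint := integrable_quadratic_of_mem_hyperrectangle (A := A) d q ξ hP
  obtain ⟨t, s⟩ := z
  obtain ⟨ht, hs⟩ := hz
  obtain ⟨π, hprob, hfst, hc, rfl⟩ := hP
  change π.map Prod.fst = diracSum θ ξ at hfst
  -- The points `ξ l` may coincide, so `s` need not be a function of the point; the minimum over
  -- coinciding indices is one. Off the atoms the infimum is over an empty type, which matters only
  -- on a null set.
  let S : Space d → ℝ := fun x => ⨅ l : {l // ξ l = x}, s l
  have hSle : ∀ l, S (ξ l) ≤ s l := fun l =>
    ciInf_le (Set.finite_range _).bddBelow (⟨l, rfl⟩ : {m // ξ m = ξ l})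
  have hae : ∀ᵐ y ∂π, y.1 ∈ Set.range ξ := by
    refine ae_of_ae_map (p := (· ∈ Set.range ξ)) measurable_fst.aemeasurable ?_
    rw [hfst]
    exact ae_diracSum_mem_range hθ ξ
  have hSint : Integrable S (π.map Prod.fst) := by
    rw [hfst]; exact integrable_diracSum _ _ _
  have hSint' : Integrable (fun y => S y.1) π := hSint.comp_measurable measurable_fst
  have hcost := fun k => integrable_cost d k (hc k)
  have hcint : Integrable (fun y => ∑ k, t k * ‖component d k (y.1 - y.2)‖ ^ 2) π :=
    integrable_finsetSum _ fun k _ => (hcost k).const_mul _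
  calc ∫ x, quadratic d A q x ∂π.map Prod.snd = ∫ y, quadratic d A q y.2 ∂π :=
        integral_map measurable_snd.aemeasurable hint.aestronglyMeasurable
    _ ≤ ∫ y, (S y.1 + ∑ k, t k * ‖component d k (y.1 - y.2)‖ ^ 2) ∂π := by
        refine integral_mono_ae (hint.comp_measurable measurable_snd) (hSint'.add hcint) ?_
        filter_upwards [hae] with y hy
        obtain ⟨l, hl⟩ := hy
        have : Nonempty {l // ξ l = y.1} := ⟨⟨l, hl⟩⟩
        have hle : quadratic d A q y.2 - ∑ k, t k * ‖component d k (y.1 - y.2)‖ ^ 2 ≤ S y.1 :=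
          le_ciInf fun m => by
            have := quadratic_le_of_posSemidef d q hA (hs m) y.2
            rw [m.2] at this
            exact sub_le_iff_le_add.2 this
        exact sub_le_iff_le_add.1 hle
    _ = ∑ l, θ l * S (ξ l) + ∑ k, t k * ∫ y, ‖component d k (y.1 - y.2)‖ ^ 2 ∂π := by
        rw [integral_add hSint' hcint, integral_finsetSum _ fun k _ => (hcost k).const_mul _]
        simp only [integral_const_mul]
        rw [← integral_map measurable_fst.aemeasurable hSint.aestronglyMeasurable, hfst,
          integral_diracSum hθ]
    _ ≤ ∑ k, t k * ε k ^ 2 + ∑ l, θ l * s l := by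
        rw [add_comm]
        exact add_le_add
          (Finset.sum_le_sum fun k _ => mul_le_mul_of_nonneg_left
            (integral_cost_le d k (hε k) (hc k)) (ht k))
          (Finset.sum_le_sum fun l _ => mul_le_mul_of_nonneg_left (hSle l) (hθ l))

end WeakDuality

/-! ### Strong duality. -/

section StrongDuality

variable {n M : ℕ} (d : Fin n → ℕ) {A : Matrix (Fin (∑ k, d k)) (Fin (∑ k, d k)) ℝ}
  (q : Fin (∑ k, d k) → ℝ) {ε : Fin n → ℝ} {θ : Fin M → ℝ} (ξ : Fin M → Space d)

/-- The rank-one tests of the dual pair `(t, s)` are the recentred LMI, so the pair is feasible for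
the SDP and its value is at least `r`. -/
theorem mem_momentCone_of_le_sdpValue (hA : A.IsSymm) (hθ : ∀ l, 0 ≤ θ l) {r : ℝ}
    (hr : (r : EReal) ≤ sdpValue d A q ε θ ξ) :
    (fun k => ε k ^ 2, θ, r) ∈ momentCone (blockOf d) fun l => shiftedMatrix d A q (ξ l) := by
  refine mem_momentCone_of_forall_le _ _ (fun k => sq_nonneg _) hθ fun t s ht hts => ?_
  have hmem : (t, s) ∈ sdpFeasible d A q ξ := by
    refine ⟨ht, fun l => (posSemidef_lmiMatrix_iff d q hA _ _ _).2 fun z w => ?_⟩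
    have := hts l (Sum.elim z fun _ => w)
    rw [shiftedMatrix, pairing_bordered] at this
    simpa only [blockTrace_vecMulVec, dotProduct_blockDiag_mulVec, Sum.elim_inr] using this
  exact EReal.coe_le_coe_iff.1 (hr.trans (iInf₂_le (t, s) hmem))

end StrongDuality

end MTH

theorem mainTheorem6 {n M : ℕ} (d : Fin n → ℕ)
    (A : Matrix (Fin (∑ k, d k)) (Fin (∑ k, d k)) ℝ) (hA : A.IsSymm)
    (q : Fin (∑ k, d k) → ℝ)
    (ε : Fin n → ℝ) (hε : ∀ k, 0 ≤ ε k)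
    (θ : Fin M → ℝ) (hθ : ∀ l, 0 ≤ θ l) (hθ_sum : ∑ l, θ l = 1)
    (ξ : Fin M → MTH.Space d) :
    (∀ P ∈ MTH.hyperrectangle d 2 (MTH.discrete d θ ξ) ε,
      Integrable (MTH.quadratic d A q) P) ∧
    MTH.worstCase (MTH.hyperrectangle d 2 (MTH.discrete d θ ξ) ε) (MTH.quadratic d A q)
      = MTH.sdpValue d A q ε θ ξ := by
  refine ⟨fun P hP => MTH.integrable_quadratic_of_mem_hyperrectangle d q ξ hP, le_antisymm ?_ ?_⟩
  · exact iSup₂_le fun P hP => le_iInf₂ fun z hz =>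
      EReal.coe_le_coe_iff.2 (MTH.integral_quadratic_le d q ξ hA hε hθ hP hz)
  -- Testing real `r` below the SDP value also covers an infeasible program, whose value is `⊤`.
  · refine EReal.ge_of_forall_gt_iff_ge.1 fun r hr => ?_
    obtain ⟨P, hP, hrP⟩ := MTH.exists_mem_hyperrectangle_of_mem_momentCone d q ξ hA hε hθ hθ_sum
      (MTH.mem_momentCone_of_le_sdpValue d q ξ hA hθ hr.le)
    exact (EReal.coe_le_coe_iff.2 hrP).trans (le_iSup₂ (f := fun P _ =>
      ((∫ x, MTH.quadratic d A q x ∂P : ℝ) : EReal)) P hP)
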